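/- Consider $N$ players, player $i\in[N]$ having the action set $\Delta_i=\{x_i\in\mathbb R_+^{n_i+1}:\sum_{j=1}^{n_i+1}x_i^j=1\}$. On $\Delta=\Delta_1\times\dots\times\Delta_N$ let the utilities (to be maximized) be $$f_i(x)=\sum_{k\neq i}x_i^TQ_{ik}x_k+\sum_{j=1}^N r_j^Tx_j,$$ with arbitrary real matrices $Q_{ik}=(q_{ik}^{jl})\in\mathbb R^{(n_i+1)\times(n_k+1)}$ and vectors $r_j\in\mathbb R^{n_j+1}$. Put $\delta_f=\max_{i\in[N]}(\max_{\Delta}f_i-\min_{\Delta}f_i)$, and let $\tau>0$ satisfy $\tau\delta_f\le 1$ and $\tau\delta_f^2\le 1$ (that is, $\tau\le\min\{1/\delta_f,1/\delta_f^2\}$ if $\delta_f>0$). Let $\Gamma^{\tau,t}$ be the entropy-regularized game in reduced coordinates: player $i$ chooses $x_i=(x_i^1,\dots,x_i^{n_i})\in\Delta_i^t=\{x_i\in\mathbb R_+^{n_i}:\sum_{j=1}^{n_i}x_i^j\le 1\}$ and maximizes $$f_i^{\tau,t}(x)=f_i^t(x)-\tau\sum_{j=1}^{n_i}x_i^j\ln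 x_i^j-\tau\Big(1-\sum_{j=1}^{n_i}x_i^j\Big)\ln\Big(1-\sum_{j=1}^{n_i}x_i^j\Big)\qquad(0\ln 0=0),$$ where $f_i^t$ is $f_i$ with $x_k^{n_k+1}=1-\sum_{j=1}^{n_k}x_k^j$ substituted for every $k\in[N]$. A Nash equilibrium (NE) of $\Gamma^{\tau,t}$ is a point $x\in\prod_i\Delta_i^t$ with $f_i^{\tau,t}(x_i,x_{-i})\ge f_i^{\tau,t}(y_i,x_{-i})$ for all $i\in[N]$ and $y_i\in\Delta_i^t$. Let $$\hat\Delta^\tau=\prod_{i=1}^N\Big\{x_i\in\mathbb R^{n_i}:\ x_i^j\ge\frac{e^{-1/\tau^2}}{\max_k n_k+1}\ \ \forall j\in[n_i],\quad \sum_{j=1}^{n_i}x_i^j\le 1-\frac{e^{-1/\tau^{1.5}}}{\max_k n_k+1}\Big\},$$ and for $i\in[N]$, $j\in[n_i]$ let $$l_{i,j}^\tau(x)=\Big(\hat r_i^j+\sum_{k\ne i}\sum_{l=1}^{n_k}\hat q_{ik}^{jl}x_k^l-\tau\ln x_i^j+\tau\ln\Big(1-\sum_{\ell=1}^{n_i}x_i^\ell\Big)\Big)^2,$$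 where $$\hat q_{ik}^{jl}=q_{ik}^{jl}-q_{ik}^{n_i+1,l}-q_{ik}^{j,n_k+1}+q_{ik}^{n_i+1,n_k+1},\qquad \hat r_i^j=r_i^j-r_i^{n_i+1}+\sum_{k\neq i}\big(q_{ik}^{j,n_k+1}-q_{ik}^{n_i+1,n_k+1}\big)$$ are the coefficients of $x_i^jx_k^l$ and of $x_i^j$ in $f_i^t$. Consider the multi-objective problem $\min_{x\in\hat\Delta^\tau}l_{i,j}^\tau(x)$, $i\in[N]$, $j\in[n_i]$. It has a solution, i.e. a point of $\hat\Delta^\tau$ that minimizes all the $l_{i,j}^\tau$ over $\hat\Delta^\tau$ simultaneously, at which every objective equals $0$. Moreover, its solution set is exactly the set of Nash equilibria of $\Gamma^{\tau,t}$, both when a solution is understood as a simultaneous minimizer of all objectives and when it is understood as a Pareto-optimal point of $\hat\Delta^\tau$. -/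

import Mathlib

open scoped Matrix BigOperators

noncomputable section

/-- Nash equilibria of the game with action sets `A i` and utilities `u i` (to be maximized). -/
def nashSet {ι : Type*} [DecidableEq ι] {X : ι → Type*} (A : ∀ i, Set (X i))
    (u : ι → (∀ i, X i) → ℝ) : Set (∀ i, X i) :=
  {x | (∀ i, x i ∈ A i) ∧ ∀ i, ∀ y ∈ A i, u i (Function.update x i y) ≤ u i x}

/-- Solutions of the multi-objective problem `min_{x ∈ S} l k x`, `k : κ`, in the strong sense:
feasible points that minimize every objective simultaneously. -/
def multiMinimizers {X κ : Type*} (S : Set X) (l : κ → X → ℝ) : Set X :=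
  {x | x ∈ S ∧ ∀ k, IsMinOn (l k) S x}

/-- Solutions of the multi-objective problem `min_{x ∈ S} l k x`, `k : κ`, in the Pareto sense:
feasible points not dominated by any other feasible point. -/
def paretoMinimizers {X κ : Type*} (S : Set X) (l : κ → X → ℝ) : Set X :=
  {x | x ∈ S ∧ ¬ ∃ y ∈ S, (∀ k, l k y ≤ l k x) ∧ ∃ k, l k y < l k x}

/-- Data of a game over simplices with `N` players: player `i` has `n i + 1` pure actions, and
the utilities are given by the matrices `Q i k` (used for `k ≠ i` only) and the vectors `r j`. -/
structure SimplexGame (N : ℕ) where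
  n : Fin N → ℕ
  Q : ∀ i k : Fin N, Matrix (Fin (n i + 1)) (Fin (n k + 1)) ℝ
  r : ∀ j : Fin N, Fin (n j + 1) → ℝ

namespace SimplexGame

variable {N : ℕ} (G : SimplexGame N)

/-- Joint mixed action profiles: all `n i + 1` coordinates of each player. -/
abbrev Profile : Type := ∀ i : Fin N, Fin (G.n i + 1) → ℝ

/-- Profiles in reduced coordinates: the first `n i` coordinates of each player. -/
abbrev RProfile : Type := ∀ i : Fin N, Fin (G.n i) → ℝ

/-- The joint action set `Δ`, the product of the simplices. -/
def jointSimplex : Set G.Profile := {x | ∀ i, x i ∈ stdSimplex ℝ (Fin (G.n i + 1))}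

/-- `f_i(x) = ∑_{k ≠ i} x_iᵀ Q_{ik} x_k + ∑_j r_jᵀ x_j`. -/
def utility (i : Fin N) (x : G.Profile) : ℝ :=
  (∑ k ∈ Finset.univ.erase i, x i ⬝ᵥ (G.Q i k *ᵥ x k)) + ∑ j, G.r j ⬝ᵥ x j

/-- `δ_f = max_i (max_Δ f_i - min_Δ f_i)`; the extrema are attained, since `Δ` is a nonempty
compact set on which `f_i` is continuous. -/
def utilityRange : ℝ :=
  ⨆ i, (sSup (G.utility i '' G.jointSimplex) - sInf (G.utility i '' G.jointSimplex))

/-- The entropy-regularized utility `f_i^τ(x) = f_i(x) - τ ∑_j x_i^j ln x_i^j`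
(with `0 ln 0 = 0`). -/
def regUtility (τ : ℝ) (i : Fin N) (x : G.Profile) : ℝ :=
  G.utility i x - τ * ∑ j, x i j * Real.log (x i j)

/-- The transformation: the last coordinate of each player is `1` minus the sum of the others. -/
def lift (y : G.RProfile) : G.Profile :=
  fun i => Fin.snoc (α := fun _ => ℝ) (y i) (1 - ∑ j, y i j)

/-- `Δ_i^t`. -/
def redSimplex (i : Fin N) : Set (Fin (G.n i) → ℝ) :=
  {y | (∀ j, 0 ≤ y j) ∧ ∑ j, y j ≤ 1}

/-- `f_i^t`, the utility in reduced coordinates. -/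
def redUtility (i : Fin N) (y : G.RProfile) : ℝ := G.utility i (G.lift y)

/-- `f_i^{τ,t}`, the regularized utility in reduced coordinates. -/
def redRegUtility (τ : ℝ) (i : Fin N) (y : G.RProfile) : ℝ := G.regUtility τ i (G.lift y)

/-- The Nash equilibria of the regularized game `Γ^{τ,t}` in reduced coordinates. -/
def redRegNash (τ : ℝ) : Set G.RProfile := nashSet G.redSimplex (G.redRegUtility τ)

/-- The matrix `Q̂_{ik}` of the bilinear term of `f_i^t` in `(y_i, y_k)`. -/
def Qhat (i k : Fin N) : Matrix (Fin (G.n i)) (Fin (G.n k)) ℝ :=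
  Matrix.of fun j l =>
    G.Q i k j.castSucc l.castSucc - G.Q i k (Fin.last _) l.castSucc
      - G.Q i k j.castSucc (Fin.last _) + G.Q i k (Fin.last _) (Fin.last _)

/-- The vector `r̂_i` of the linear term of `f_i^t` in player `i`'s own coordinates `y_i`. -/
def rhat (i : Fin N) : Fin (G.n i) → ℝ := fun j =>
  G.r i j.castSucc - G.r i (Fin.last _)
    + ∑ k ∈ Finset.univ.erase i,
        (G.Q i k j.castSucc (Fin.last _) - G.Q i k (Fin.last _) (Fin.last _))

/-- `max_i n_i`. -/
def maxDim : ℕ := Finset.univ.sup G.n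

/-- `Δ̂_i^τ`. -/
def truncSimplex (τ : ℝ) (i : Fin N) : Set (Fin (G.n i) → ℝ) :=
  {y | (∀ j, Real.exp (-1 / τ ^ 2) / ((G.maxDim : ℝ) + 1) ≤ y j) ∧
    ∑ j, y j ≤ 1 - Real.exp (-1 / τ ^ (3 / 2 : ℝ)) / ((G.maxDim : ℝ) + 1)}

/-- `Δ̂^τ = ∏_i Δ̂_i^τ`. -/
def truncJoint (τ : ℝ) : Set G.RProfile := {y | ∀ i, y i ∈ G.truncSimplex τ i}

/-- The objective `l_{i,j}^τ`, indexed by the pairs `p = ⟨i, j⟩` with `j ∈ [n_i]`. -/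
def objective (τ : ℝ) (p : Σ i : Fin N, Fin (G.n i)) (y : G.RProfile) : ℝ :=
  (G.rhat p.1 p.2 + (∑ k ∈ Finset.univ.erase p.1, G.Qhat p.1 k p.2 ⬝ᵥ y k)
    - τ * Real.log (y p.1 p.2) + τ * Real.log (1 - ∑ l, y p.1 l)) ^ 2

/-- The regularized utility in reduced coordinates, written out. -/
theorem redRegUtility_eq (τ : ℝ) (i : Fin N) (y : G.RProfile) :
    G.redRegUtility τ i y = G.redUtility i y - τ * ∑ j, y i j * Real.log (y i j)
      - τ * ((1 - ∑ j, y i j) * Real.log (1 - ∑ j, y i j)) := by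
  simp only [redRegUtility, regUtility, redUtility, lift, Fin.sum_univ_castSucc,
    Fin.snoc_castSucc, Fin.snoc_last]
  ring

/-- `Q̂` and `r̂` are the coefficients of `f_i^t`: up to terms `c` that do not involve player `i`'s
own coordinates, `f_i^t(y) = ∑_{k ≠ i} y_iᵀ Q̂_{ik} y_k + r̂_iᵀ y_i`. -/
theorem redUtility_eq (i : Fin N) : ∃ c : G.RProfile → ℝ,
    (∀ y z, c (Function.update y i z) = c y) ∧
    ∀ y, G.redUtility i y =
      (∑ k ∈ Finset.univ.erase i, y i ⬝ᵥ (G.Qhat i k *ᵥ y k)) + G.rhat i ⬝ᵥ y i + c y := by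
  refine ⟨fun y => (∑ k ∈ Finset.univ.erase i,
      ((∑ l, G.Q i k (Fin.last _) l.castSucc * y k l)
        + G.Q i k (Fin.last _) (Fin.last _) * (1 - ∑ l, y k l)))
      + (∑ k ∈ Finset.univ.erase i, G.r k ⬝ᵥ G.lift y k) + G.r i (Fin.last _), ?_, ?_⟩
  · intro y z
    have h : ∀ k ∈ Finset.univ.erase i, Function.update y i z k = y k := fun k hk =>
      Function.update_of_ne (Finset.ne_of_mem_erase hk) z y
    simp only [lift]
    congr 2 <;> exact Finset.sum_congr rfl fun k hk => by rw [h k hk]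
  · intro y
    have hr : G.rhat i ⬝ᵥ y i + G.r i (Fin.last _) = G.r i ⬝ᵥ G.lift y i
        + ∑ k ∈ Finset.univ.erase i,
          ∑ j, (G.Q i k j.castSucc (Fin.last _) - G.Q i k (Fin.last _) (Fin.last _)) * y i j := by
      rw [Finset.sum_comm]
      simp only [dotProduct, rhat, lift, Fin.sum_univ_castSucc, Fin.snoc_castSucc,
        Fin.snoc_last, add_mul, sub_mul, Finset.sum_add_distrib, Finset.sum_sub_distrib,
        ← Finset.sum_mul, mul_sub, Finset.mul_sum]
      ring
    have hQ : ∀ k, G.lift y i ⬝ᵥ (G.Q i k *ᵥ G.lift y k) =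
        y i ⬝ᵥ (G.Qhat i k *ᵥ y k)
        + ∑ j, (G.Q i k j.castSucc (Fin.last _) - G.Q i k (Fin.last _) (Fin.last _)) * y i j
        + ((∑ l, G.Q i k (Fin.last _) l.castSucc * y k l)
        + G.Q i k (Fin.last _) (Fin.last _) * (1 - ∑ l, y k l)) := by
      intro k
      have e : y i ⬝ᵥ (G.Qhat i k *ᵥ y k) =
          (∑ j, y i j * ∑ l, G.Q i k j.castSucc l.castSucc * y k l)
          - (∑ j, y i j) * (∑ l, G.Q i k (Fin.last _) l.castSucc * y k l)
          - (∑ j, y i j * G.Q i k j.castSucc (Fin.last _)) * (∑ l, y k l)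
          + G.Q i k (Fin.last _) (Fin.last _) * (∑ j, y i j) * (∑ l, y k l) := by
        simp only [dotProduct, Matrix.mulVec, Qhat, Matrix.of_apply, add_mul, sub_mul,
          Finset.sum_add_distrib, Finset.sum_sub_distrib, mul_add, mul_sub, ← Finset.mul_sum,
          ← Finset.sum_mul]
        simp only [← mul_assoc, ← Finset.sum_mul]
        ring
      rw [e]
      simp only [dotProduct, Matrix.mulVec, lift, Fin.sum_univ_castSucc, Fin.snoc_castSucc,
        Fin.snoc_last, mul_add, Finset.sum_add_distrib, sub_mul, Finset.sum_sub_distrib,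
        ← Finset.mul_sum]
      simp only [← mul_assoc, ← Finset.sum_mul, mul_comm (G.Q i k _ (Fin.last _)) (y i _)]
      ring
    have hs : (∑ j, G.r j ⬝ᵥ G.lift y j) =
        (∑ k ∈ Finset.univ.erase i, G.r k ⬝ᵥ G.lift y k) + G.r i ⬝ᵥ G.lift y i :=
      (Finset.sum_erase_add _ _ (Finset.mem_univ i)).symm
    simp only [redUtility, utility, hQ, hs]
    rw [Finset.sum_add_distrib, Finset.sum_add_distrib]
    linarith [hr]

end SimplexGame

end

/-! ### A fixed-point theorem for bounded C¹ maps, by a volume argument. -/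

section FixedPoint

open MeasureTheory Set Metric
open scoped NNReal ENNReal

variable {E : Type*} [NormedAddCommGroup E] [InnerProductSpace ℝ E] [FiniteDimensional ℝ E]

/-! With the other players fixed, player `i`'s regularized utility is a constant minus `τ` times the
Kullback–Leibler divergence from `i`'s mixed action to the softmax of `i`'s payoffs over `τ`. By
Gibbs' inequality the Nash equilibria are exactly the profiles of mutual softmax responses
(`redRegNash_eq_logitEquilibria`). Taking logarithms of the ratios to the last action turns this
condition into the vanishing of every `l_{i,j}`, provided all probabilities are positive.

The bounds on `τ` keep each softmax response inside the truncated set: payoffs differ by at most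
`δ_f`, so each probability is at least `exp (-δ_f / τ) / (n_i + 1)`.

A logit equilibrium exists because it is a fixed point of a bounded C¹ map on the space of payoffs.
The objectives are squares with a common feasible zero, so simultaneous minimizers, Pareto points
and common zeros coincide. -/

omit [FiniteDimensional ℝ E] in
theorem ContinuousLinearMap.det_ne_zero_of_isUnit {T : E →L[ℝ] E} (hT : IsUnit T) :
    T.det ≠ 0 :=
  ((hT.map (ContinuousLinearMap.toLinearMapRingHom (R₁ := ℝ) (M₁ := E))).map
    (LinearMap.det (M := E) (A := ℝ))).ne_zero

/-- By the Neumann series `1 + s • T` is invertible for `s ∈ [0, 1]`, so its determinant cannot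
change sign from its value `1` at `s = 0`. -/
theorem ContinuousLinearMap.det_one_add_pos {T : E →L[ℝ] E} (hT : ‖T‖ < 1) :
    0 < (1 + T).det := by
  have hne : ∀ s ∈ Icc (0 : ℝ) 1, (1 + s • T).det ≠ 0 := by
    intro s hs
    apply ContinuousLinearMap.det_ne_zero_of_isUnit
    have h : ‖-(s • T)‖ < 1 := by
      rw [norm_neg, norm_smul, Real.norm_of_nonneg hs.1]
      exact lt_of_le_of_lt (mul_le_of_le_one_left (norm_nonneg T) hs.2) hT
    simpa using isUnit_one_sub_of_norm_lt_one h
  by_contra hneg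
  have hc : ContinuousOn (fun s : ℝ => (1 + s • T).det) (Icc 0 1) :=
    (ContinuousLinearMap.continuous_det.comp (by fun_prop)).continuousOn
  have h0 : (1 + (0 : ℝ) • T).det = 1 := by simp [ContinuousLinearMap.det]
  obtain ⟨s, hs, hs0⟩ := intermediate_value_Icc' zero_le_one hc
    (show (0 : ℝ) ∈ Icc _ _ from ⟨by simpa using not_lt.1 hneg, by simp [ContinuousLinearMap.det]⟩)
  exact hne s hs hs0

/-- In `s`, `det (1 + s • T)` is a polynomial of degree at most `dim E`, so Lagrange interpolation
recovers its value at `1` from nodes near `0`. The weights do not depend on `T`, so the formula can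
be integrated over a family of operators. -/
theorem ContinuousLinearMap.exists_det_one_add_eq_sum (E : Type*) [NormedAddCommGroup E]
    [InnerProductSpace ℝ E] [FiniteDimensional ℝ E] {ε : ℝ} (hε : 0 < ε) :
    ∃ (m : ℕ) (c t : Fin m → ℝ), (∀ k, 0 < t k ∧ t k < ε) ∧
      ∀ T : E →L[ℝ] E, (1 + T).det = ∑ k, c k * (1 + t k • T).det := by
  classical
  set d := Module.finrank ℝ E
  let t : Fin (d + 1) → ℝ := fun k => ε / ((k : ℝ) + 2)
  have hinj : Function.Injective t := by
    intro a b h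
    simp only [t] at h
    rw [div_eq_div_iff (by positivity) (by positivity)] at h
    have h' := mul_left_cancel₀ hε.ne' h
    apply Fin.ext
    have : (b : ℝ) = a := by linarith
    exact_mod_cast this.symm
  refine ⟨d + 1, fun k => (Lagrange.basis Finset.univ t k).eval 1, t, fun k => ⟨by positivity, ?_⟩,
    fun T => ?_⟩
  · exact div_lt_self hε (by have : (0 : ℝ) ≤ (k : ℕ) := Nat.cast_nonneg _; linarith)
  · let b := Module.finBasis ℝ E
    let A := LinearMap.toMatrix b b (T : E →ₗ[ℝ] E)
    let p : Polynomial ℝ :=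
      ((Polynomial.X : Polynomial ℝ) • A.map Polynomial.C
        + (1 : Matrix (Fin d) (Fin d) ℝ).map Polynomial.C).det
    have hp : ∀ s : ℝ, p.eval s = (1 + s • T).det := by
      intro s
      have h1 : (1 + s • T).det = (1 + s • A).det := by
        change LinearMap.det ((1 + s • T : E →L[ℝ] E) : E →ₗ[ℝ] E) = _
        rw [← LinearMap.det_toMatrix b]
        congr 1
        simp [A, LinearMap.toMatrix_one]
      rw [h1]
      have h2 := RingHom.map_det (Polynomial.evalRingHom s)
        ((Polynomial.X : Polynomial ℝ) • A.map Polynomial.C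
        + (1 : Matrix (Fin d) (Fin d) ℝ).map Polynomial.C)
      simp only [Polynomial.coe_evalRingHom] at h2
      change Polynomial.eval s p = _ at h2
      rw [h2]
      congr 1
      ext i j
      simp [add_comm, Matrix.one_apply, apply_ite]
      exact mul_comm _ _
    have hdeg : p.degree < (Finset.univ : Finset (Fin (d + 1))).card := by
      refine lt_of_le_of_lt Polynomial.degree_le_natDegree ?_
      have := Polynomial.natDegree_det_X_add_C_le A (1 : Matrix (Fin d) (Fin d) ℝ)
      rw [Fintype.card_fin] at this
      rw [Finset.card_univ, Fintype.card_fin]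
      exact_mod_cast Nat.lt_succ_of_le this
    have h3 := Lagrange.eq_interpolate (hinj.injOn (s := _)) hdeg
    have h4 := congrArg (Polynomial.eval 1) h3
    rw [hp, one_smul, Lagrange.interpolate_apply, Polynomial.eval_finsetSum] at h4
    rw [h4]
    refine Finset.sum_congr rfl fun k _ => ?_
    rw [Polynomial.eval_mul, Polynomial.eval_C, hp, mul_comm]

omit [FiniteDimensional ℝ E] in
/-- A function that is Lipschitz on a closed ball and vanishes off the open ball is Lipschitz. -/
theorem LipschitzOnWith.lipschitzWith_indicator_ball {F : Type*} [NormedAddCommGroup F]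
    {g : E → F} {K : ℝ≥0} {R : ℝ} (hg : LipschitzOnWith K g (closedBall 0 R))
    (h0 : ∀ x ∈ sphere (0 : E) R, g x = 0) :
    LipschitzWith K ((closedBall (0 : E) R).indicator g) := by
  classical
  have key : ∀ x ∈ closedBall (0 : E) R, ∀ y ∉ closedBall (0 : E) R, ‖g x‖ ≤ K * ‖x - y‖ := by
    intro x hx y hy
    rw [mem_closedBall_zero_iff] at hx
    rw [mem_closedBall_zero_iff, not_le] at hy
    -- The segment from `x` to `y` crosses the sphere, where `g` vanishes.
    have hc : ContinuousOn (fun s : ℝ => ‖x + s • (y - x)‖) (Icc 0 1) := by fun_prop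
    obtain ⟨s, hs, hsR⟩ := intermediate_value_Icc zero_le_one hc
      (show R ∈ Icc _ _ from ⟨by simpa using hx, by simpa using hy.le⟩)
    have hz : x + s • (y - x) ∈ sphere (0 : E) R := by simpa using hsR
    have h := hg.norm_sub_le (mem_closedBall_zero_iff.2 hx) (sphere_subset_closedBall hz)
    rw [h0 _ hz, sub_zero] at h
    refine h.trans (mul_le_mul_of_nonneg_left ?_ K.2)
    rw [sub_add_cancel_left, norm_neg, norm_smul, Real.norm_of_nonneg hs.1, norm_sub_rev x y]
    exact mul_le_of_le_one_left (norm_nonneg _) hs.2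
  refine LipschitzWith.of_dist_le_mul fun x y => ?_
  rw [dist_eq_norm, dist_eq_norm]
  by_cases hx : x ∈ closedBall (0 : E) R <;> by_cases hy : y ∈ closedBall (0 : E) R
  · simpa [indicator_of_mem hx, indicator_of_mem hy] using hg.norm_sub_le hx hy
  · simpa [indicator_of_mem hx, indicator_of_notMem hy] using key x hx y hy
  · rw [norm_sub_rev x y]
    simpa [indicator_of_mem hy, indicator_of_notMem hx] using key y hy x hx
  · simp only [indicator_of_notMem hx, indicator_of_notMem hy, sub_zero, norm_zero]
    positivity

theorem LipschitzWith.bijective_id_add_smul {g : E → E} {K : ℝ≥0} (hg : LipschitzWith K g) {t : ℝ}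
    (ht : 0 ≤ t) (htK : t * K < 1) : Function.Bijective fun x => x + t • g x := by
  constructor
  · intro x y hxy
    by_contra hne
    have h : x - y = t • (g y - g x) := by
      rw [smul_sub, sub_eq_sub_iff_add_eq_add]
      simpa [add_comm] using hxy
    have h1 : ‖x - y‖ ≤ t * K * ‖x - y‖ := by
      calc ‖x - y‖ = t * ‖g y - g x‖ := by rw [h, norm_smul, Real.norm_of_nonneg ht]
        _ ≤ t * (K * ‖y - x‖) := mul_le_mul_of_nonneg_left (hg.norm_sub_le y x) ht
        _ = _ := by rw [norm_sub_rev, mul_assoc]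
    have h2 : 0 < ‖x - y‖ := norm_pos_iff.2 (sub_ne_zero.2 hne)
    nlinarith
  · intro y
    -- A preimage of `y` is a fixed point of the contraction `x ↦ y - t • g x`.
    have hc : ContractingWith (t.toNNReal * K) (fun x => y - t • g x) := by
      refine ⟨by rw [← NNReal.coe_lt_coe, NNReal.coe_mul, Real.coe_toNNReal t ht]; exact htK, LipschitzWith.of_dist_le_mul fun a b => ?_⟩
      rw [dist_sub_left, dist_smul₀, Real.norm_of_nonneg ht, NNReal.coe_mul,
        Real.coe_toNNReal t ht, mul_assoc]
      exact mul_le_mul_of_nonneg_left (hg.dist_le_mul a b) ht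
    refine ⟨hc.fixedPoint, ?_⟩
    have := hc.fixedPoint_isFixedPt
    unfold Function.IsFixedPt at this
    simp only at this
    exact (eq_sub_iff_add_eq.1 this.symm)

/-- Differentiating the constant `‖r‖ ^ 2` shows that the range of the derivative is orthogonal to
`r x ≠ 0`, so the derivative is not onto. -/
theorem ContinuousLinearMap.det_fderiv_eq_zero_of_norm_eq {r : E → E} {R : ℝ} (hR : 0 < R) {x : E}
    (hr : DifferentiableAt ℝ r x) (hn : ∀ᶠ y in nhds x, ‖r y‖ = R) : (fderiv ℝ r x).det = 0 := by
  by_contra hne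
  have h1 : HasFDerivAt (fun y => ‖r y‖ ^ 2) (0 : E →L[ℝ] ℝ) x :=
    (hasFDerivAt_const (R ^ 2) x).congr_of_eventuallyEq (hn.mono fun y hy => by simp [hy])
  have h2 := hr.hasFDerivAt.norm_sq.unique h1
  have hu : IsUnit (LinearMap.det (fderiv ℝ r x : E →ₗ[ℝ] E)) := isUnit_iff_ne_zero.2 hne
  have hsurj := ((Module.End.isUnit_iff _).1 ((LinearMap.isUnit_iff_isUnit_det _).2 hu)).surjective
  obtain ⟨v, hv⟩ := hsurj (r x)
  have hv' : fderiv ℝ r x v = r x := hv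
  have h3 := congrArg (fun L : E →L[ℝ] ℝ => L v) h2
  simp [hv', hn.self_of_nhds] at h3
  exact hR.ne' h3

/-- For small `t` the map `x + t • (r x - x)` carries the ball bijectively onto itself, so its
Jacobian integrates to the volume of the ball. Interpolation extends this to `t = 1`, where the
Jacobian `det Dr` vanishes: a contradiction. -/
theorem not_exists_contDiff_retraction_sphere {R : ℝ} (hR : 0 < R) :
    ¬ ∃ r : E → E, ContDiff ℝ 1 r ∧ (∀ x ∈ sphere (0 : E) R, r x = x) ∧
      ∀ x ∈ ball (0 : E) R, ‖r x‖ = R := by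
  rintro ⟨r, hr, hrs, hrn⟩
  borelize E
  set g : E → E := fun x => r x - x with hg
  have hgc : ContDiff ℝ 1 g := hr.sub contDiff_id
  have hgd : Differentiable ℝ g := hgc.differentiable one_ne_zero
  have hDc : Continuous (fderiv ℝ g) := hgc.continuous_fderiv one_ne_zero
  obtain ⟨C, hC⟩ := (isCompact_closedBall (0 : E) R).exists_bound_of_continuousOn hDc.continuousOn
  set K : ℝ≥0 := C.toNNReal
  have hK : ∀ x ∈ closedBall (0 : E) R, ‖fderiv ℝ g x‖₊ ≤ K := fun x hx => by
    rw [← NNReal.coe_le_coe]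
    exact (hC x hx).trans (Real.le_coe_toNNReal C)
  have hlip : LipschitzWith K ((closedBall (0 : E) R).indicator g) :=
    ((convex_closedBall 0 R).lipschitzOnWith_of_nnnorm_fderiv_le (fun x _ => hgd x)
      hK).lipschitzWith_indicator_ball fun x hx => by simp [hg, hrs x hx]
  have hcont : ∀ t : ℝ, Continuous fun x => (1 + t • fderiv ℝ g x).det := fun t =>
    ContinuousLinearMap.continuous_det.comp (by fun_prop)
  have hint : ∀ t : ℝ, IntegrableOn (fun x => (1 + t • fderiv ℝ g x).det) (ball (0 : E) R) :=
    fun t => ((hcont t).continuousOn.integrableOn_compact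
      (isCompact_closedBall (0 : E) R)).mono_set ball_subset_closedBall
  have hvol : ∀ t : ℝ, 0 < t → t < 1 / (K + 1 : ℝ) →
      ∫ x in ball (0 : E) R, (1 + t • fderiv ℝ g x).det = volume.real (ball (0 : E) R) := by
    intro t ht0 ht1
    have htK : t * K < 1 := by
      rw [lt_div_iff₀ (by positivity)] at ht1
      nlinarith
    set f : E → E := fun x => x + t • (closedBall (0 : E) R).indicator g x with hf
    have hbij : Function.Bijective f := hlip.bijective_id_add_smul ht0.le htK
    have hfix : ∀ x ∈ (ball (0 : E) R)ᶜ, f x = x := by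
      intro x hx
      by_cases hx' : x ∈ closedBall (0 : E) R
      · have : x ∈ sphere (0 : E) R := by
          rw [← closedBall_sdiff_ball]
          exact ⟨hx', hx⟩
        simp [hf, hg, indicator_of_mem hx', hrs x this]
      · simp [hf, indicator_of_notMem hx']
    -- A bijection that fixes every point of the complement preserves the ball.
    have himg : f '' ball (0 : E) R = ball (0 : E) R := by
      rw [← compl_inj_iff, ← image_compl_eq hbij, image_congr hfix, image_id']
    have hder : ∀ x ∈ ball (0 : E) R,
        HasFDerivWithinAt f (1 + t • fderiv ℝ g x) (ball (0 : E) R) x := by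
      intro x hx
      have h1 : HasFDerivAt (fun x => x + t • g x) (1 + t • fderiv ℝ g x) x :=
        (hasFDerivAt_id x).add ((hgd x).hasFDerivAt.const_smul t)
      refine h1.hasFDerivWithinAt.congr (fun y hy => ?_) ?_
      · simp [hf, indicator_of_mem (ball_subset_closedBall hy)]
      · simp [hf, indicator_of_mem (ball_subset_closedBall hx)]
    have hpos : ∀ x ∈ ball (0 : E) R, 0 < (1 + t • fderiv ℝ g x).det := by
      intro x hx
      apply ContinuousLinearMap.det_one_add_pos
      rw [norm_smul, Real.norm_of_nonneg ht0.le]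
      exact lt_of_le_of_lt (mul_le_mul_of_nonneg_left (hK x (ball_subset_closedBall hx)) ht0.le) htK
    have hl := lintegral_abs_det_fderiv_eq_addHaar_image volume measurableSet_ball hder
      hbij.injective.injOn
    rw [himg] at hl
    rw [integral_eq_lintegral_of_nonneg_ae
      ((ae_restrict_iff' measurableSet_ball).2 (Filter.Eventually.of_forall fun x hx =>
        (hpos x hx).le)) (hcont t).aestronglyMeasurable, measureReal_def, ← hl]
    congr 1
    refine setLIntegral_congr_fun measurableSet_ball fun x hx => ?_
    simp only [abs_of_pos (hpos x hx)]
  obtain ⟨m, c, t, ht, hct⟩ := ContinuousLinearMap.exists_det_one_add_eq_sum E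
    (ε := 1 / (K + 1 : ℝ)) (by positivity)
  have hc1 : ∑ k, c k = 1 := by
    simpa [ContinuousLinearMap.det] using (hct 0).symm
  have hzero : ∀ x ∈ ball (0 : E) R, (1 + fderiv ℝ g x).det = 0 := by
    intro x hx
    have h1 : fderiv ℝ g x = fderiv ℝ r x - 1 := by
      exact ((hr.differentiable one_ne_zero x).hasFDerivAt.sub (hasFDerivAt_id x)).fderiv
    rw [h1, add_sub_cancel]
    exact ContinuousLinearMap.det_fderiv_eq_zero_of_norm_eq hR (hr.differentiable one_ne_zero x)
      (Filter.mem_of_superset (isOpen_ball.mem_nhds hx) hrn)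
  have h1 : ∫ x in ball (0 : E) R, (1 + fderiv ℝ g x).det = volume.real (ball (0 : E) R) := by
    rw [show (fun x => (1 + fderiv ℝ g x).det) =
      fun x => ∑ k, c k * (1 + t k • fderiv ℝ g x).det from funext fun x => hct _]
    rw [integral_finsetSum _ fun k _ => (hint (t k)).const_mul (c k)]
    simp_rw [integral_const_mul, hvol _ (ht _).1 (ht _).2, ← Finset.sum_mul, hc1, one_mul]
  rw [setIntegral_congr_fun measurableSet_ball hzero] at h1
  simp only [integral_zero] at h1
  have h2 : 0 < volume.real (ball (0 : E) R) :=
    ENNReal.toReal_pos (measure_ball_pos _ _ hR).ne' measure_ball_lt_top.ne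
  exact h2.ne h1

/-- A bounded continuously differentiable self-map of a finite-dimensional space has a fixed
point. -/
theorem exists_fixedPoint_of_contDiff_of_bounded {Φ : E → E} (hΦ : ContDiff ℝ 1 Φ) {M : ℝ}
    (hM : ∀ z, ‖Φ z‖ ≤ M) : ∃ z, Φ z = z := by
  by_contra! hne
  have hM0 : 0 ≤ M := (norm_nonneg _).trans (hM 0)
  -- A fixed point of `χ • Φ` has norm at most `M`, where `χ = 1`, so it would be fixed by `Φ`.
  -- Hence `u` never vanishes; it is the identity on the sphere of radius `M + 2`, and rescaling it
  -- to that norm gives a forbidden retraction.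
  let χ : ContDiffBump (0 : E) := ⟨M + 1, M + 2, by linarith, by linarith⟩
  let u : E → E := fun z => z - χ z • Φ z
  have hu : ∀ z, u z ≠ 0 := by
    intro z hz
    have hz' : z = χ z • Φ z := sub_eq_zero.1 hz
    by_cases hzM : z ∈ closedBall (0 : E) (M + 1)
    · rw [χ.one_of_mem_closedBall hzM, one_smul] at hz'
      exact hne z hz'.symm
    · rw [mem_closedBall_zero_iff, not_le] at hzM
      have h1 : ‖z‖ ≤ M := by
        rw [hz', norm_smul, Real.norm_of_nonneg χ.nonneg]
        exact (mul_le_of_le_one_left (norm_nonneg _) χ.le_one).trans (hM z)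
      linarith
  have huc : ContDiff ℝ 1 u := contDiff_id.sub (χ.contDiff.smul hΦ)
  refine not_exists_contDiff_retraction_sphere (E := E) (R := M + 2) (by linarith)
    ⟨fun z => ((M + 2) * ‖u z‖⁻¹) • u z, ?_, fun z hz => ?_, fun z _ => ?_⟩
  · exact (contDiff_const.mul ((huc.norm ℝ hu).inv fun z => norm_ne_zero_iff.2 (hu z))).smul huc
  · have h0 : χ z = 0 := χ.zero_of_le_dist (le_of_eq (mem_sphere.1 hz).symm)
    have hn : ‖z‖ = M + 2 := by simpa using hz
    have h2 : u z = z := by simp [u, h0]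
    simp only [h2, hn]
    rw [mul_inv_cancel₀ (by linarith), one_smul]
  · rw [norm_smul, norm_mul, norm_inv, norm_norm, mul_assoc,
      inv_mul_cancel₀ (norm_ne_zero_iff.2 (hu z)), mul_one, Real.norm_of_nonneg (by linarith)]

end FixedPoint

/-! ### Gibbs' inequality and the softmax distribution. -/

section Softmax

variable {ι : Type*} [Fintype ι]

/-- The correction `-q + p` cancels when summed over two vectors of equal mass, leaving terms that
are nonnegative and vanish only for `p = q`. -/
theorem mul_log_sub_log_eq_mul_klFun {p q : ℝ} (hq : 0 < q) :
    p * (Real.log p - Real.log q) = q * InformationTheory.klFun (p / q) - q + p := by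
  rcases eq_or_ne p 0 with rfl | hp
  · simp [InformationTheory.klFun_zero]
  · rw [InformationTheory.klFun, Real.log_div hp hq.ne']
    field_simp
    ring

theorem sum_mul_log_sub_log_eq_sum_klFun {p q : ι → ℝ} (hq : ∀ j, 0 < q j)
    (hpq : ∑ j, p j = ∑ j, q j) :
    ∑ j, p j * (Real.log (p j) - Real.log (q j)) =
      ∑ j, q j * InformationTheory.klFun (p j / q j) := by
  simp_rw [fun j => mul_log_sub_log_eq_mul_klFun (p := p j) (hq j), Finset.sum_add_distrib,
    Finset.sum_sub_distrib, hpq]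
  ring

/-- Gibbs' inequality. -/
theorem sum_mul_log_sub_log_nonneg {p q : ι → ℝ} (hp : ∀ j, 0 ≤ p j) (hq : ∀ j, 0 < q j)
    (hpq : ∑ j, p j = ∑ j, q j) : 0 ≤ ∑ j, p j * (Real.log (p j) - Real.log (q j)) := by
  rw [sum_mul_log_sub_log_eq_sum_klFun hq hpq]
  exact Finset.sum_nonneg fun j _ =>
    mul_nonneg (hq j).le (InformationTheory.klFun_nonneg (div_nonneg (hp j) (hq j).le))

/-- The equality case of Gibbs' inequality. -/
theorem eq_of_sum_mul_log_sub_log_nonpos {p q : ι → ℝ} (hp : ∀ j, 0 ≤ p j) (hq : ∀ j, 0 < q j)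
    (hpq : ∑ j, p j = ∑ j, q j) (h : ∑ j, p j * (Real.log (p j) - Real.log (q j)) ≤ 0) :
    p = q := by
  rw [sum_mul_log_sub_log_eq_sum_klFun hq hpq] at h
  have hnn : ∀ j ∈ Finset.univ, 0 ≤ q j * InformationTheory.klFun (p j / q j) := fun j _ =>
    mul_nonneg (hq j).le (InformationTheory.klFun_nonneg (div_nonneg (hp j) (hq j).le))
  have h0 := (Finset.sum_eq_zero_iff_of_nonneg hnn).1 (le_antisymm h (Finset.sum_nonneg hnn))
  funext j
  have h1 := (mul_eq_zero.1 (h0 j (Finset.mem_univ j))).resolve_left (hq j).ne'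
  rw [InformationTheory.klFun_eq_zero_iff (div_nonneg (hp j) (hq j).le),
    div_eq_one_iff_eq (hq j).ne'] at h1
  exact h1

/-- The softmax distribution with logits `v`. -/
noncomputable def softmax (v : ι → ℝ) (j : ι) : ℝ := Real.exp (v j) / ∑ a, Real.exp (v a)

variable [Nonempty ι]

theorem sum_exp_pos (v : ι → ℝ) : 0 < ∑ a, Real.exp (v a) :=
  Finset.sum_pos (fun a _ => Real.exp_pos (v a)) Finset.univ_nonempty

theorem softmax_pos (v : ι → ℝ) (j : ι) : 0 < softmax v j :=
  div_pos (Real.exp_pos _) (sum_exp_pos v)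

theorem sum_softmax (v : ι → ℝ) : ∑ j, softmax v j = 1 := by
  simp only [softmax, ← Finset.sum_div]
  exact div_self (sum_exp_pos v).ne'

theorem softmax_le_one (v : ι → ℝ) (j : ι) : softmax v j ≤ 1 := by
  rw [← sum_softmax v]
  exact Finset.single_le_sum (fun a _ => (softmax_pos v a).le) (Finset.mem_univ j)

theorem log_softmax (v : ι → ℝ) (j : ι) :
    Real.log (softmax v j) = v j - Real.log (∑ a, Real.exp (v a)) := by
  rw [softmax, Real.log_div (Real.exp_pos _).ne' (sum_exp_pos v).ne', Real.log_exp]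

theorem eq_softmax_of_eq_const_mul_exp {p v : ι → ℝ} {c : ℝ} (h : ∀ j, p j = c * Real.exp (v j))
    (hp : ∑ j, p j = 1) : p = softmax v := by
  have hc : c * ∑ a, Real.exp (v a) = 1 := by
    rw [← hp, Finset.mul_sum]
    exact Finset.sum_congr rfl fun j _ => (h j).symm
  funext j
  rw [softmax, eq_div_iff (sum_exp_pos v).ne', h j, mul_right_comm, hc, one_mul]

theorem exp_neg_div_card_le_softmax {v : ι → ℝ} {δ : ℝ} {j : ι} (h : ∀ a, v a ≤ v j + δ) :
    Real.exp (-δ) / Fintype.card ι ≤ softmax v j := by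
  have hc : (0 : ℝ) < Fintype.card ι := by exact_mod_cast Fintype.card_pos
  rw [softmax, div_le_div_iff₀ hc (sum_exp_pos v)]
  calc Real.exp (-δ) * ∑ a, Real.exp (v a)
      ≤ Real.exp (-δ) * ∑ _a : ι, Real.exp (v j + δ) := by
        gcongr with a
        exact h a
    _ = _ := by
        rw [Finset.sum_const, Finset.card_univ, nsmul_eq_mul, mul_left_comm, ← Real.exp_add,
          neg_add_cancel_comm_assoc, mul_comm]

end Softmax

/-! ### Nash equilibria of the regularized game as logit equilibria. -/

noncomputable section

namespace SimplexGame

variable {N : ℕ} (G : SimplexGame N)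

/-- The payoff of pure action `j` of player `i` relative to the last pure action. -/
def gain (i : Fin N) (y : G.RProfile) (j : Fin (G.n i)) : ℝ :=
  G.rhat i j + ∑ k ∈ Finset.univ.erase i, G.Qhat i k j ⬝ᵥ y k

/-- The payoffs of all pure actions of player `i` relative to the last one. -/
def payoff (i : Fin N) (y : G.RProfile) : Fin (G.n i + 1) → ℝ :=
  Fin.snoc (α := fun _ => ℝ) (G.gain i y) 0

/-- The profiles in which all players play logit responses at temperature `τ`. -/
def logitEquilibria (τ : ℝ) : Set G.RProfile :=
  {y | ∀ i, G.lift y i = softmax fun a => G.payoff i y a / τ}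

variable {G}

@[simp] theorem payoff_castSucc (i : Fin N) (y : G.RProfile) (j : Fin (G.n i)) :
    G.payoff i y j.castSucc = G.gain i y j := by simp [payoff]

@[simp] theorem payoff_last (i : Fin N) (y : G.RProfile) :
    G.payoff i y (Fin.last _) = 0 := by simp [payoff]

@[simp] theorem lift_castSucc (i : Fin N) (y : G.RProfile) (j : Fin (G.n i)) :
    G.lift y i j.castSucc = y i j := by simp [lift]

@[simp] theorem lift_last (i : Fin N) (y : G.RProfile) :
    G.lift y i (Fin.last _) = 1 - ∑ j, y i j := by simp [lift]

theorem sum_lift (i : Fin N) (y : G.RProfile) : ∑ a, G.lift y i a = 1 := by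
  simp [Fin.sum_univ_castSucc]

theorem lift_nonneg {i : Fin N} {y : G.RProfile} (hy : y i ∈ G.redSimplex i)
    (a : Fin (G.n i + 1)) : 0 ≤ G.lift y i a := by
  refine Fin.lastCases ?_ (fun j => ?_) a
  · simpa using hy.2
  · simpa using hy.1 j

theorem lift_mem_jointSimplex {y : G.RProfile} (hy : ∀ i, y i ∈ G.redSimplex i) :
    G.lift y ∈ G.jointSimplex := fun i => ⟨lift_nonneg (hy i), sum_lift i y⟩

theorem mem_redSimplex_of_lift_nonneg {i : Fin N} {y : G.RProfile}
    (h : ∀ a, 0 ≤ G.lift y i a) : y i ∈ G.redSimplex i :=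
  ⟨fun j => by simpa using h j.castSucc, by simpa using h (Fin.last _)⟩

theorem gain_update (i : Fin N) (x : G.RProfile) (y : Fin (G.n i) → ℝ) :
    G.gain i (Function.update x i y) = G.gain i x := by
  funext j
  simp only [gain]
  congr 1
  exact Finset.sum_congr rfl fun k hk => by rw [Function.update_of_ne (Finset.ne_of_mem_erase hk)]

theorem payoff_update (i : Fin N) (x : G.RProfile) (y : Fin (G.n i) → ℝ) :
    G.payoff i (Function.update x i y) = G.payoff i x := by
  rw [payoff, gain_update, payoff]

/-- Own utility is affine in the own mixed action, with slopes `payoff`; normalizing the last payoff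
to `0` only shifts the constant. -/
theorem exists_redUtility_update_eq (i : Fin N) (x : G.RProfile) : ∃ C : ℝ,
    ∀ y, G.redUtility i (Function.update x i y) =
      (∑ a, G.lift (Function.update x i y) i a * G.payoff i x a) + C := by
  obtain ⟨c, hc, h⟩ := G.redUtility_eq i
  refine ⟨c x, fun y => ?_⟩
  rw [h, hc]
  congr 1
  rw [Fin.sum_univ_castSucc]
  simp only [lift_castSucc, payoff_castSucc, payoff_last, mul_zero, add_zero,
    Function.update_self]
  have h1 : ∀ k ∈ Finset.univ.erase i, y ⬝ᵥ (G.Qhat i k *ᵥ Function.update x i y k) =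
      y ⬝ᵥ (G.Qhat i k *ᵥ x k) := fun k hk => by
    rw [Function.update_of_ne (Finset.ne_of_mem_erase hk)]
  rw [Finset.sum_congr rfl h1]
  simp only [gain, mul_add, Finset.sum_add_distrib, Finset.mul_sum]
  rw [Finset.sum_comm, add_comm, dotProduct_comm]
  rfl

theorem continuous_utility (i : Fin N) : Continuous (G.utility i) := by
  unfold utility dotProduct Matrix.mulVec dotProduct
  fun_prop

theorem isCompact_jointSimplex : IsCompact G.jointSimplex := by
  have : G.jointSimplex = Set.univ.pi fun i => stdSimplex ℝ (Fin (G.n i + 1)) := by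
    ext x
    simp [jointSimplex]
  rw [this]
  exact isCompact_univ_pi fun i => isCompact_stdSimplex ℝ _

theorem utility_sub_le_utilityRange (i : Fin N) {x y : G.Profile} (hx : x ∈ G.jointSimplex)
    (hy : y ∈ G.jointSimplex) : G.utility i x - G.utility i y ≤ G.utilityRange := by
  have hK := (isCompact_jointSimplex (G := G)).image (continuous_utility i)
  have h1 := le_csSup hK.bddAbove (Set.mem_image_of_mem (G.utility i) hx)
  have h2 := csInf_le hK.bddBelow (Set.mem_image_of_mem (G.utility i) hy)
  have h3 := le_ciSup (Set.finite_range fun i =>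
    sSup (G.utility i '' G.jointSimplex) - sInf (G.utility i '' G.jointSimplex)).bddAbove i
  unfold utilityRange
  linarith

/-- A payoff difference is the utility difference between two pure deviations, hence at most `δ_f`.
-/
theorem payoff_le_payoff_add_utilityRange {x : G.RProfile} (hx : ∀ i, x i ∈ G.redSimplex i)
    (i : Fin N) (a b : Fin (G.n i + 1)) :
    G.payoff i x a ≤ G.payoff i x b + G.utilityRange := by
  obtain ⟨C, hC⟩ := exists_redUtility_update_eq i x
  -- Pure action `a` in reduced coordinates; the last action is the zero vector.
  let e : Fin (G.n i + 1) → Fin (G.n i) → ℝ := fun a j => if j.castSucc = a then 1 else 0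
  have hl : ∀ a b, G.lift (Function.update x i (e a)) i b = if b = a then 1 else 0 := by
    intro a b
    refine Fin.lastCases ?_ (fun j => ?_) b
    · refine Fin.lastCases ?_ (fun j => ?_) a
      · simp [e, Fin.castSucc_ne_last]
      · simp [e, (Fin.castSucc_ne_last _).symm]
    · simp [e]
  have hmem : ∀ a, G.lift (Function.update x i (e a)) ∈ G.jointSimplex := by
    intro a
    refine lift_mem_jointSimplex fun k => ?_
    rcases eq_or_ne k i with rfl | hk
    · refine mem_redSimplex_of_lift_nonneg fun b => ?_
      rw [hl]
      split_ifs <;> norm_num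
    · rw [Function.update_of_ne hk]
      exact hx k
  have hu : ∀ a, G.utility i (G.lift (Function.update x i (e a))) = G.payoff i x a + C := by
    intro a
    have := hC (e a)
    simp only [hl, ite_mul, one_mul, zero_mul, Finset.sum_ite_eq',
      Finset.mem_univ, if_true] at this
    exact this
  have := utility_sub_le_utilityRange i (hmem a) (hmem b)
  rw [hu, hu] at this
  linarith

/-- Gibbs variational principle: the subtracted sum is the divergence from the softmax response, and
the log-partition term goes into `C`. -/
theorem exists_redRegUtility_update_eq {τ : ℝ} (hτ : 0 < τ) (i : Fin N) (x : G.RProfile) :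
    ∃ C : ℝ, ∀ y, G.redRegUtility τ i (Function.update x i y) =
      C - τ * ∑ a, G.lift (Function.update x i y) i a *
        (Real.log (G.lift (Function.update x i y) i a)
          - Real.log (softmax (fun a => G.payoff i x a / τ) a)) := by
  obtain ⟨C, hC⟩ := exists_redUtility_update_eq i x
  refine ⟨C + τ * Real.log (∑ a, Real.exp (G.payoff i x a / τ)), fun y => ?_⟩
  have h1 := hC y
  have h2 := sum_lift i (Function.update x i y)
  unfold redUtility at h1
  unfold redRegUtility regUtility
  set p := G.lift (Function.update x i y) i
  set L := Real.log (∑ a, Real.exp (G.payoff i x a / τ))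
  rw [h1]
  have h3 : τ * ∑ a, p a * (Real.log (p a)
      - Real.log (softmax (fun a => G.payoff i x a / τ) a)) =
      τ * ∑ a, p a * Real.log (p a) - ∑ a, p a * G.payoff i x a + τ * L * ∑ a, p a := by
    simp only [log_softmax, Finset.mul_sum, ← Finset.sum_sub_distrib, ← Finset.sum_add_distrib]
    refine Finset.sum_congr rfl fun a _ => ?_
    field_simp
    ring
  rw [h3, h2]
  ring

/-- The Nash equilibria of the entropy-regularized game are its logit equilibria. -/
theorem redRegNash_eq_logitEquilibria {τ : ℝ} (hτ : 0 < τ) :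
    G.redRegNash τ = G.logitEquilibria τ := by
  have hsm : ∀ (x : G.RProfile) (i : Fin N),
      ∑ a, G.lift x i a = ∑ a, softmax (fun a => G.payoff i x a / τ) a := fun x i => by
    rw [sum_lift, sum_softmax]
  ext x
  constructor
  · rintro ⟨hx, hN⟩ i
    obtain ⟨C, hC⟩ := exists_redRegUtility_update_eq hτ i x
    set s := softmax fun a => G.payoff i x a / τ with hs
    -- Deviating to the softmax response makes the divergence zero, so optimality of `x i` forces
    -- its own divergence to be at most zero.
    let y : Fin (G.n i) → ℝ := fun j => s j.castSucc
    have hy : G.lift (Function.update x i y) i = s := by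
      funext a
      refine Fin.lastCases ?_ (fun j => ?_) a
      · have := sum_softmax fun a => G.payoff i x a / τ
        rw [Fin.sum_univ_castSucc] at this
        simp only [lift_last, Function.update_self, y, hs]
        linarith
      · simp [y]
    have hym : y ∈ G.redSimplex i := by
      have := mem_redSimplex_of_lift_nonneg (y := Function.update x i y) (i := i)
        fun a => by rw [hy]; exact (softmax_pos _ a).le
      simpa using this
    have h1 := hN i y hym
    have h2 := hC (x i)
    rw [Function.update_eq_self] at h2
    rw [h2, hC, hy] at h1
    simp only [sub_self, mul_zero, Finset.sum_const_zero, sub_zero] at h1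
    refine eq_of_sum_mul_log_sub_log_nonpos (lift_nonneg (hx i)) (softmax_pos _) (hsm x i) ?_
    nlinarith
  · intro hx
    refine ⟨fun i => mem_redSimplex_of_lift_nonneg fun a => ?_, fun i y hy => ?_⟩
    · rw [hx i]
      exact (softmax_pos _ a).le
    · obtain ⟨C, hC⟩ := exists_redRegUtility_update_eq hτ i x
      have h2 := hC (x i)
      rw [Function.update_eq_self, hx i] at h2
      simp only [sub_self, mul_zero, Finset.sum_const_zero, sub_zero] at h2
      rw [h2, hC]
      have h3 := sum_mul_log_sub_log_nonneg (p := G.lift (Function.update x i y) i)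
        (lift_nonneg (by simpa using hy)) (softmax_pos fun a => G.payoff i x a / τ)
        (by rw [hsm, payoff_update])
      nlinarith

/-! ### Zeros of the objectives, the truncated set, and existence. -/

theorem objective_eq {τ : ℝ} (p : Σ i : Fin N, Fin (G.n i)) (y : G.RProfile) :
    G.objective τ p y = (G.gain p.1 y p.2 - τ * Real.log (y p.1 p.2)
      + τ * Real.log (1 - ∑ l, y p.1 l)) ^ 2 := rfl

theorem objective_nonneg {τ : ℝ} (p : Σ i : Fin N, Fin (G.n i)) (y : G.RProfile) :
    0 ≤ G.objective τ p y := sq_nonneg _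

theorem objective_eq_zero_of_mem_logitEquilibria {τ : ℝ} (hτ : 0 < τ) {x : G.RProfile}
    (hx : x ∈ G.logitEquilibria τ) (p : Σ i : Fin N, Fin (G.n i)) : G.objective τ p x = 0 := by
  have h1 := congrFun (hx p.1) p.2.castSucc
  have h2 := congrFun (hx p.1) (Fin.last _)
  rw [lift_castSucc] at h1
  rw [lift_last] at h2
  rw [objective_eq, h1, h2, log_softmax, log_softmax, payoff_castSucc, payoff_last]
  field_simp
  ring

theorem truncSimplex_pos {τ : ℝ} {i : Fin N} {y : Fin (G.n i) → ℝ} (hy : y ∈ G.truncSimplex τ i) :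
    (∀ j, 0 < y j) ∧ 0 < 1 - ∑ j, y j := by
  refine ⟨fun j => lt_of_lt_of_le (by positivity) (hy.1 j), ?_⟩
  have h1 := hy.2
  have h2 : 0 < Real.exp (-1 / τ ^ (3 / 2 : ℝ)) / ((G.maxDim : ℝ) + 1) := by positivity
  linarith

/-- Zero objectives say that each probability is the last one times `exp (payoff / τ)`, and
normalization then forces softmax. Truncation supplies the positivity needed to undo the logarithms.
-/
theorem mem_logitEquilibria_of_objective_eq_zero {τ : ℝ} (hτ : 0 < τ) {x : G.RProfile}
    (hx : x ∈ G.truncJoint τ) (h : ∀ p, G.objective τ p x = 0) : x ∈ G.logitEquilibria τ := by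
  intro i
  obtain ⟨hpos, hlast⟩ := truncSimplex_pos (hx i)
  refine eq_softmax_of_eq_const_mul_exp (c := 1 - ∑ j, x i j) (fun a => ?_) (sum_lift i x)
  refine Fin.lastCases ?_ (fun j => ?_) a
  · simp
  · rw [lift_castSucc, payoff_castSucc]
    have h1 := h ⟨i, j⟩
    rw [objective_eq, sq_eq_zero_iff] at h1
    have h2 : G.gain i x j / τ = Real.log (x i j) - Real.log (1 - ∑ j, x i j) := by
      field_simp
      linarith
    rw [h2, Real.exp_sub, Real.exp_log (hpos j), Real.exp_log hlast]
    field_simp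

theorem mem_truncJoint_of_mem_logitEquilibria {τ : ℝ} (hτ : 0 < τ)
    (hτ₁ : τ * G.utilityRange ≤ 1) (hτ₂ : τ * G.utilityRange ^ 2 ≤ 1) {x : G.RProfile}
    (hx : x ∈ G.logitEquilibria τ) : x ∈ G.truncJoint τ := by
  have hred : ∀ i, x i ∈ G.redSimplex i := fun i => mem_redSimplex_of_lift_nonneg fun a => by
    rw [hx i]
    exact (softmax_pos _ a).le
  have hbound : ∀ (i : Fin N) (t : ℝ), G.utilityRange / τ ≤ t → ∀ a,
      Real.exp (-t) / ((G.maxDim : ℝ) + 1) ≤ G.lift x i a := by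
    intro i t ht a
    have h1 : Real.exp (-t) / (Fintype.card (Fin (G.n i + 1)) : ℝ) ≤ G.lift x i a := by
      rw [hx i]
      refine exp_neg_div_card_le_softmax fun b => ?_
      refine le_trans ?_ (add_le_add_right ht _)
      rw [← add_div]
      exact div_le_div_of_nonneg_right (payoff_le_payoff_add_utilityRange hred i b a) hτ.le
    refine le_trans ?_ h1
    have h2 : G.n i ≤ G.maxDim := Finset.le_sup (Finset.mem_univ i)
    rw [Fintype.card_fin]
    push_cast
    gcongr
  intro i
  constructor
  · intro j
    -- `τ δ_f ≤ 1` gives `δ_f / τ ≤ 1 / τ ^ 2`.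
    have := hbound i (1 / τ ^ 2) (by
      rw [div_le_div_iff₀ hτ (by positivity)]
      nlinarith) j.castSucc
    rwa [lift_castSucc, ← neg_div] at this
  -- `τ δ_f ^ 2 ≤ 1` gives `√τ δ_f ≤ 1`, that is `δ_f / τ ≤ 1 / τ ^ (3 / 2)`.
  · have := hbound i (1 / τ ^ (3 / 2 : ℝ)) (by
      have h32 : τ ^ (3 / 2 : ℝ) = τ * √τ := by
        rw [show (3 / 2 : ℝ) = 1 + 1 / 2 by norm_num, Real.rpow_add hτ, Real.rpow_one,
          Real.sqrt_eq_rpow]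
      have hs : √τ * G.utilityRange ≤ 1 := by
        refine le_of_abs_le ((sq_le_one_iff_abs_le_one _).1 ?_)
        rwa [mul_pow, Real.sq_sqrt hτ.le]
      rw [h32, div_le_div_iff₀ hτ (by positivity)]
      nlinarith) (Fin.last _)
    rw [lift_last, ← neg_div] at this
    linarith

/-- The profile of softmax distributions with logits `z / τ`. -/
def logitProfile (G : SimplexGame N) (τ : ℝ) (z : EuclideanSpace ℝ (Σ i : Fin N, Fin (G.n i))) :
    G.RProfile := fun i j =>
  softmax (fun a => (Fin.snoc (α := fun _ => ℝ) (fun l => z ⟨i, l⟩) 0 : _ → ℝ) a / τ) j.castSucc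

theorem contDiff_logitProfile (τ : ℝ) : ContDiff ℝ 1 (G.logitProfile τ) := by
  rw [contDiff_pi]
  intro i
  rw [contDiff_pi]
  intro j
  simp only [logitProfile, softmax, Fin.sum_univ_castSucc, Fin.snoc_castSucc, Fin.snoc_last]
  refine ContDiff.div (by fun_prop) (by fun_prop) fun z => ?_
  positivity

/-- The fixed point is sought among payoff vectors rather than mixed profiles: payoffs to softmax
responses to payoffs is a C¹ self-map of a whole Euclidean space, bounded because the responses lie
in the unit cube. -/
theorem logitEquilibria_nonempty (τ : ℝ) : (G.logitEquilibria τ).Nonempty := by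
  let g : G.RProfile → EuclideanSpace ℝ (Σ i : Fin N, Fin (G.n i)) := fun y =>
    WithLp.toLp 2 fun p => G.gain p.1 y p.2
  have hg : ContDiff ℝ 1 g := by
    rw [contDiff_euclidean]
    intro p
    have hproj : ∀ (k : Fin N) (l : Fin (G.n k)), ContDiff ℝ 1 fun y : G.RProfile => y k l :=
      fun k l => contDiff_pi.1 (contDiff_pi.1 contDiff_id k) l
    exact contDiff_const.add (ContDiff.sum fun k _ => ContDiff.sum fun l _ =>
      contDiff_const.mul (hproj k l))
  obtain ⟨M, hM⟩ := (isCompact_Icc (a := (0 : G.RProfile)) (b := 1)).exists_bound_of_continuousOn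
    hg.continuous.continuousOn
  obtain ⟨z, hz⟩ := exists_fixedPoint_of_contDiff_of_bounded
    (hg.comp (contDiff_logitProfile τ)) (M := M) fun z => hM _
      ⟨fun i j => (softmax_pos _ _).le, fun i j => softmax_le_one _ _⟩
  refine ⟨G.logitProfile τ z, fun i => ?_⟩
  have hgain : G.gain i (G.logitProfile τ z) = fun l => z ⟨i, l⟩ := by
    funext l
    exact congrArg (fun w : EuclideanSpace ℝ (Σ i : Fin N, Fin (G.n i)) => w ⟨i, l⟩) hz
  funext a
  rw [payoff, hgain]
  refine Fin.lastCases ?_ (fun j => ?_) a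
  · have := sum_softmax fun a =>
      (Fin.snoc (α := fun _ => ℝ) (fun l => z ⟨i, l⟩) 0 : Fin (G.n i + 1) → ℝ) a / τ
    rw [Fin.sum_univ_castSucc] at this
    rw [lift_last]
    simp only [logitProfile]
    linarith
  · rw [lift_castSucc]
    rfl

end SimplexGame

theorem multiMinimizers_eq_zeros {X κ : Type*} {S : Set X} {l : κ → X → ℝ} (hl : ∀ k x, 0 ≤ l k x)
    (hex : ∃ x ∈ S, ∀ k, l k x = 0) : multiMinimizers S l = {x | x ∈ S ∧ ∀ k, l k x = 0} := by
  obtain ⟨x₀, hx₀, h₀⟩ := hex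
  ext x
  refine and_congr_right fun _ => forall_congr' fun k => ⟨fun h => ?_, fun h y _ => ?_⟩
  · exact le_antisymm (h₀ k ▸ h hx₀) (hl k x)
  · simpa [h] using hl k y

/-- A common zero dominates every feasible point at which some nonnegative objective is positive. -/
theorem paretoMinimizers_eq_zeros {X κ : Type*} {S : Set X} {l : κ → X → ℝ}
    (hl : ∀ k x, 0 ≤ l k x) (hex : ∃ x ∈ S, ∀ k, l k x = 0) :
    paretoMinimizers S l = {x | x ∈ S ∧ ∀ k, l k x = 0} := by
  obtain ⟨x₀, hx₀, h₀⟩ := hex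
  ext x
  refine and_congr_right fun _ => ⟨fun h k => ?_, ?_⟩
  · by_contra hk
    exact h ⟨x₀, hx₀, fun k => by rw [h₀]; exact hl k x, k, by
      rw [h₀]; exact lt_of_le_of_ne (hl k x) (Ne.symm hk)⟩
  · rintro h ⟨y, _, _, k, hk⟩
    rw [h k] at hk
    exact absurd (hl k y) (not_le.2 hk)

end

theorem mainTheorem3 {N : ℕ} (G : SimplexGame N) (τ : ℝ) (hτ : 0 < τ)
    (hτ₁ : τ * G.utilityRange ≤ 1) (hτ₂ : τ * G.utilityRange ^ 2 ≤ 1) :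
    (∃ x ∈ multiMinimizers (G.truncJoint τ) (G.objective τ),
      ∀ p : Σ i : Fin N, Fin (G.n i), G.objective τ p x = 0) ∧
    multiMinimizers (G.truncJoint τ) (G.objective τ) = G.redRegNash τ ∧
    paretoMinimizers (G.truncJoint τ) (G.objective τ) = G.redRegNash τ := by
  have hzeros : {x | x ∈ G.truncJoint τ ∧ ∀ p, G.objective τ p x = 0} = G.logitEquilibria τ := by
    ext x
    exact ⟨fun h => SimplexGame.mem_logitEquilibria_of_objective_eq_zero hτ h.1 h.2, fun h =>
      ⟨SimplexGame.mem_truncJoint_of_mem_logitEquilibria hτ hτ₁ hτ₂ h,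
        SimplexGame.objective_eq_zero_of_mem_logitEquilibria hτ h⟩⟩
  obtain ⟨x, hx⟩ := SimplexGame.logitEquilibria_nonempty (G := G) τ
  have hx' := hx
  rw [← hzeros] at hx'
  have hnn : ∀ p y, 0 ≤ G.objective τ p y := SimplexGame.objective_nonneg
  rw [multiMinimizers_eq_zeros hnn ⟨x, hx'⟩, paretoMinimizers_eq_zeros hnn ⟨x, hx'⟩, hzeros,
    SimplexGame.redRegNash_eq_logitEquilibria hτ]
  exact ⟨⟨x, hx, hx'.2⟩, rfl, rfl⟩
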